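/- A \emph{geodesic} from $x$ to $y$ in a metric space $X$ is an isometric embedding $\gamma\colon[0,d(x,y)]\to X$ with $\gamma(0)=x$ and $\gamma(d(x,y))=y$. A metric space $X$ is called \emph{uniformly convex} if it is complete, any two points are joined by a unique geodesic, and for each $\epsilon>0$ there is $\delta>0$ such that for all $x,y,z\in X$ with $d(x,y)\ge\epsilon\max(d(x,z),d(y,z))$ the midpoint $m$ of the geodesic from $x$ to $y$ satisfies $d(z,m)\le(1-\delta)\max(d(x,z),d(y,z))$. A subset of $X$ is convex if it contains the geodesic between any two of its points. Let $\mathcal X$ be a family of uniformly convex metric spaces that is closed under rescaled ultraproducts: for every index set $I$, every ultrafilter $\mathcal U$ on $I$, and all $X_i\in\mathcal X$, $\lambda_i>0$ and $x_i\in X_i$ $(i\in I)$, the ultraproduct along $\mathcal U$ of the pointed metric spaces $(X_i,\lambda_i d_{X_i},x_i)$ belongs to $\mathcal X$. (This ultraproduct is the set of families $(y_i)$ with $\sup_i\lambda_i d_{X_i}(x_i,y_i)<\infty$, with $d((y_i),(z_i))=\lim_{\mathcal U}\lambda_i d_{X_i}(y_i,z_i)$, families at distance $0$ being identified.) Assume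 moreover that - $\mathcal X$ is closed under taking non-empty closed convex subspaces, or - $\mathcal X$ consists of real Banach spaces and is closed under taking closed vector subspaces. A Hausdorff topological group $G$ has property F$\mathcal X$ if every continuous isometric action of $G$ on a non-empty space in $\mathcal X$ has a fixed point. A locally compact (Hausdorff) group is compactly generated if it is generated by a compact subset $S$, and compactly presented if it has a presentation $\langle S\mid R\rangle$ with $S$ a compact subset and $R$ a set of words in $S$ of bounded length. Let $G$ be a compactly generated locally compact group with property F$\mathcal X$. Then there exist a compactly presented locally compact group $G'$ with property F$\mathcal X$ and a continuous surjective homomorphism $G'\to G$ with discrete kernel. -/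

import Mathlib

open Filter Topology
open scoped NNReal

universe u v

namespace FixedPointFamily

/-! ### Uniformly convex metric spaces -/

section UniformConvexity

variable {X : Type u} [MetricSpace X]

/-- `γ`, restricted to `[0, d(x,y)]`, is a geodesic from `x` to `y`. -/
def IsGeodesic (x y : X) (γ : ℝ → X) : Prop :=
  γ 0 = x ∧ γ (dist x y) = y ∧
    ∀ s ∈ Set.Icc (0 : ℝ) (dist x y), ∀ t ∈ Set.Icc (0 : ℝ) (dist x y),
      dist (γ s) (γ t) = |s - t|

/-- A set is geodesically convex if it contains every geodesic between two of its points. -/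
def IsGeodesicallyConvex (A : Set X) : Prop :=
  ∀ x ∈ A, ∀ y ∈ A, ∀ γ : ℝ → X, IsGeodesic x y γ →
    ∀ t ∈ Set.Icc (0 : ℝ) (dist x y), γ t ∈ A

variable (X)

/-- Any two points are joined by exactly one geodesic. -/
def IsUniquelyGeodesic : Prop :=
  ∀ x y : X, ∃ γ : ℝ → X, IsGeodesic x y γ ∧
    ∀ γ' : ℝ → X, IsGeodesic x y γ' → Set.EqOn γ' γ (Set.Icc (0 : ℝ) (dist x y))

/-- A uniformly convex metric space: a complete uniquely geodesic metric space such that for each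
`ε > 0` there is `δ > 0` such that `|xy| ≥ ε max(|xz|,|yz|)` implies
`|z m| ≤ (1 - δ) max(|xz|,|yz|)`, where `m` is the midpoint of the geodesic from `x` to `y`. -/
structure IsUniformlyConvex : Prop where
  complete : CompleteSpace X
  uniquelyGeodesic : IsUniquelyGeodesic X
  uniform : ∀ ε : ℝ, 0 < ε → ∃ δ : ℝ, 0 < δ ∧
    ∀ (x y z : X) (γ : ℝ → X), IsGeodesic x y γ →
      ε * max (dist x z) (dist y z) ≤ dist x y →
        dist z (γ (dist x y / 2)) ≤ (1 - δ) * max (dist x z) (dist y z)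

end UniformConvexity

/-! ### Rescaled ultraproducts of pointed metric spaces -/

section Ultraproduct

variable {I : Type u}

/-- Families `(y i)` at bounded distance from the base points `(x i)`, for the rescaled metrics
`l i • d`. The ultrafilter is a parameter because the distance depends on it. -/
def PreUltraproduct (_U : Ultrafilter I) (X : I → Type u) [∀ i, MetricSpace (X i)]
    (l : I → ℝ≥0) (x : ∀ i, X i) : Type u :=
  {y : ∀ i, X i // ∃ C : ℝ, ∀ i, (l i : ℝ) * dist (x i) (y i) ≤ C}

variable (U : Ultrafilter I) (X : I → Type u) [∀ i, MetricSpace (X i)]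
    (l : I → ℝ≥0) (x : ∀ i, X i)

/-- The limit along the ultrafilter of the rescaled distances. -/
noncomputable instance : Dist (PreUltraproduct U X l x) where
  dist y z := limUnder (U : Filter I) fun i => (l i : ℝ) * dist (y.1 i) (z.1 i)

variable {U X l x}

/-- The limit that defines the distance exists. -/
theorem PreUltraproduct.tendsto_dist (y z : PreUltraproduct U X l x) :
    Tendsto (fun i => (l i : ℝ) * dist (y.1 i) (z.1 i)) (U : Filter I) (𝓝 (dist y z)) := by
  obtain ⟨C, hC⟩ := y.2
  obtain ⟨D, hD⟩ := z.2
  have hb : ∀ i, (l i : ℝ) * dist (y.1 i) (z.1 i) ∈ Set.Icc (0 : ℝ) (C + D) := by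
    intro i
    refine ⟨by positivity, ?_⟩
    have h := mul_le_mul_of_nonneg_left (dist_triangle_left (y.1 i) (z.1 i) (x i))
      (l i).coe_nonneg
    rw [mul_add] at h
    linarith [hC i, hD i]
  obtain ⟨a, -, ha⟩ := (isCompact_Icc (a := (0 : ℝ)) (b := C + D)).ultrafilter_le_nhds
    (U.map fun i => (l i : ℝ) * dist (y.1 i) (z.1 i))
    (by
      rw [le_principal_iff, Ultrafilter.mem_coe, Ultrafilter.mem_map]
      exact Filter.univ_mem' hb)
  exact tendsto_nhds_limUnder ⟨a, ha⟩

variable (U X l x)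

noncomputable instance : PseudoMetricSpace (PreUltraproduct U X l x) where
  dist_self y := by
    refine tendsto_nhds_unique (PreUltraproduct.tendsto_dist y y) ?_
    simp
  dist_comm y z := by
    refine tendsto_nhds_unique (PreUltraproduct.tendsto_dist y z) ?_
    simpa only [dist_comm] using PreUltraproduct.tendsto_dist z y
  dist_triangle y z w := by
    refine le_of_tendsto_of_tendsto' (PreUltraproduct.tendsto_dist y w)
      ((PreUltraproduct.tendsto_dist y z).add (PreUltraproduct.tendsto_dist z w)) fun i => ?_
    rw [← mul_add]
    exact mul_le_mul_of_nonneg_left (dist_triangle _ _ _) (l i).coe_nonneg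

/-- The ultraproduct along `U` of the pointed metric spaces `(X i, l i • d, x i)`: bounded families,
two families being identified when their distance is `0`. -/
abbrev RescaledUltraproduct : Type u := SeparationQuotient (PreUltraproduct U X l x)

end Ultraproduct

/-! ### Families of metric spaces -/

/-- A family (class) of metric spaces. -/
abbrev MetricFamily : Type (u + 1) := ∀ (X : Type u) [MetricSpace X], Prop

namespace MetricFamily

variable (F : MetricFamily.{u})

/-- Every member is a uniformly convex metric space. -/
def ConsistsOfUniformlyConvex : Prop :=
  ∀ (X : Type u) [MetricSpace X], F X → IsUniformlyConvex X

/-- Stability under rescaled ultraproducts. -/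
def StableUnderRescaledUltraproducts : Prop :=
  ∀ (I : Type u) (U : Ultrafilter I) (X : I → Type u) [∀ i, MetricSpace (X i)]
    (l : I → ℝ≥0) (x : ∀ i, X i), (∀ i, F (X i)) → (∀ i, 0 < l i) →
      F (RescaledUltraproduct U X l x)

/-- Stability under passing to non-empty closed geodesically convex subspaces. -/
def StableUnderClosedConvexSubspaces : Prop :=
  ∀ (X : Type u) [MetricSpace X], F X → ∀ A : Set X, A.Nonempty → IsClosed A →
    IsGeodesicallyConvex A → F A

/-- Every member is (isometric to) a real Banach space. -/
def ConsistsOfBanachSpaces : Prop :=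
  ∀ (X : Type u) [MetricSpace X], F X →
    ∃ (E : Type u) (_ : NormedAddCommGroup E) (_ : NormedSpace ℝ E),
      CompleteSpace E ∧ Nonempty (X ≃ᵢ E)

/-- Stability under passing to closed vector subspaces, for every way of viewing a member as a
real normed space (by the Mazur-Ulam theorem, these differ only in the choice of the origin). -/
def StableUnderClosedVectorSubspaces : Prop :=
  ∀ (X : Type u) [MetricSpace X], F X →
    ∀ (E : Type u) [NormedAddCommGroup E] [NormedSpace ℝ E] (e : X ≃ᵢ E) (V : Submodule ℝ E),
      IsClosed (V : Set E) → F (e ⁻¹' (V : Set E))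

end MetricFamily

/-! ### Properties of topological groups -/

section Groups

variable (G : Type v) [Group G] [TopologicalSpace G]

/-- The (topological) fixed point property for a family `F` of metric spaces: every continuous
isometric action on a (non-empty) member of `F` has a fixed point. -/
def HasFixedPointProperty (F : MetricFamily.{u}) : Prop :=
  ∀ (X : Type u) [MetricSpace X] [Nonempty X], F X →
    ∀ [MulAction G X] [IsIsometricSMul G X] [ContinuousSMul G X],
      ∃ x : X, ∀ g : G, g • x = x

/-- Some compact subset generates the group. -/
def IsCompactlyGenerated : Prop :=
  ∃ S : Set G, IsCompact S ∧ Subgroup.closure S = ⊤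

/-- `G = ⟨S | R⟩` with `S` a compact subset of `G` and `R` a set of words in `S` of bounded
length. -/
def IsCompactlyPresented : Prop :=
  ∃ S : Set G, IsCompact S ∧ Subgroup.closure S = ⊤ ∧
    ∃ (R : Set (FreeGroup S)) (n : ℕ),
      (∀ r ∈ R, ∃ w : List (S × Bool), w.length ≤ n ∧ FreeGroup.mk w = r) ∧
      Subgroup.normalClosure R = (FreeGroup.lift (fun s : S => (s : G))).ker

end Groups

end FixedPointFamily

/-! Let `S` be a compact symmetric neighbourhood of the identity generating `G`, and let
`TruncatedGroup S n` have generators `S` and the relations of `G` of length at most `n`. For `n ≥ 4`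
these relations contain the partial multiplication and conjugation on `S`, so the topology of `G`
near `1` transports to a locally compact group topology with discrete kernel over `G`
(`exists_topology`). These groups are compactly presented, so it suffices that one of them has the
fixed point property.

Otherwise each has a fixed-point-free action on a member of the family. Choosing an almost minimal
point of the displacement of `S` and rescaling (`exists_rescaled_displacement`), `S` moves the base
point by at most `1`, but some letter moves each point of a ball of radius `i + 1` by at least
`1/4`. In the ultraproduct every relation of `G` holds, so `G` acts on the part used below, but on
the whole ultraproduct orbit maps may fail to be continuous.

The remedy is to keep only the points fixed by the infinitesimal families, those given by letters
tending to `1`. They form a group with a bounded orbit, so a circumcentre argument gives fixed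
points. The fixed set lies in the family, is invariant because `S` normalises the infinitesimals,
and carries a continuous action by a diagonal argument. A fixed point of `G` there is represented by
points which, by compactness of `S`, all of `S` moves by less than `1/4` for almost all indices, a
contradiction. -/

namespace FixedPointFamily

/-! ### Isometric actions with bounded orbits on uniformly convex spaces -/

section Circumcenter

variable {X : Type u} [MetricSpace X]

/-- The circumradius function of a bounded set: points at which it is almost minimal are close to
each other. -/
theorem IsUniformlyConvex.exists_dist_le_of_almost_minimal (hX : IsUniformlyConvex X) {B : Set X}
    (hB : B.Nonempty) {ρ : ℝ} (hρ0 : 0 ≤ ρ)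
    (hρ : ∀ (y : X) (r : ℝ), (∀ b ∈ B, dist y b ≤ r) → ρ ≤ r) {ε : ℝ} (hε : 0 < ε) :
    ∃ η > 0, ∀ a b : X, (∀ z ∈ B, dist a z ≤ ρ + η) → (∀ z ∈ B, dist b z ≤ ρ + η) →
      dist a b ≤ ε := by
  obtain ⟨z₀, hz₀⟩ := hB
  rcases hρ0.eq_or_lt with rfl | hpos
  · refine ⟨ε / 2, by positivity, fun a b ha hb => ?_⟩
    have h1 := ha z₀ hz₀
    have h2 := hb z₀ hz₀
    have h3 := dist_triangle_right a b z₀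
    linarith
  · obtain ⟨δ, hδ, h⟩ := hX.uniform (ε / (2 * ρ)) (by positivity)
    -- With `η = ρ * δ'`, far apart almost minimal points would have a midpoint of radius at most
    -- `(1 - δ' ^ 2) * ρ < ρ`. The cap `1 / 2` keeps the maximum below `2 * ρ` and `1 - δ'`
    -- nonnegative.
    set δ' := min δ (1 / 2) with hδ'
    have hδ'0 : 0 < δ' := lt_min hδ (by norm_num)
    have hδ'1 : δ' ≤ 1 / 2 := min_le_right _ _
    have hδ'2 : δ' ≤ δ := min_le_left _ _
    refine ⟨ρ * δ', by positivity, fun a b ha hb => ?_⟩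
    by_contra! hab
    obtain ⟨γ, hγ, -⟩ := hX.uniquelyGeodesic a b
    have key : ρ ≤ (1 - δ') * (ρ + ρ * δ') := by
      refine hρ (γ (dist a b / 2)) _ fun z hz => ?_
      have hmax : max (dist a z) (dist b z) ≤ ρ + ρ * δ' := max_le (ha z hz) (hb z hz)
      have hmax0 : 0 ≤ max (dist a z) (dist b z) := le_max_of_le_left dist_nonneg
      have hle : ε / (2 * ρ) * max (dist a z) (dist b z) ≤ dist a b := by
        refine le_trans ?_ hab.le
        calc ε / (2 * ρ) * max (dist a z) (dist b z) ≤ ε / (2 * ρ) * (2 * ρ) := by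
              gcongr
              nlinarith
          _ = ε := by field_simp
      have h1 := h a b z γ hγ hle
      rw [dist_comm]
      calc dist z (γ (dist a b / 2)) ≤ (1 - δ) * max (dist a z) (dist b z) := h1
        _ ≤ (1 - δ') * max (dist a z) (dist b z) := by gcongr
        _ ≤ (1 - δ') * (ρ + ρ * δ') := by
          gcongr
          linarith
    nlinarith [mul_pos hpos (mul_pos hδ'0 hδ'0)]

variable {Γ : Type v} [Group Γ] [MulAction Γ X] [IsIsometricSMul Γ X]

/-- An isometric action with a bounded orbit on a uniformly convex space has a fixed point. -/
theorem IsUniformlyConvex.exists_fixedPoint (hX : IsUniformlyConvex X) (x : X) {C : ℝ}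
    (hC : ∀ g : Γ, dist (g • x) x ≤ C) : (MulAction.fixedPoints Γ X).Nonempty := by
  have := hX.complete
  set B : Set X := Set.range fun g : Γ => g • x with hBdef
  have hBne : B.Nonempty := ⟨_, 1, rfl⟩
  set T : Set ℝ := {r | ∃ y : X, ∀ b ∈ B, dist y b ≤ r} with hT
  have hTne : T.Nonempty := ⟨C, x, by rintro _ ⟨g, rfl⟩; rw [dist_comm]; exact hC g⟩
  have hT0 : ∀ r ∈ T, 0 ≤ r := by
    rintro r ⟨y, hy⟩
    obtain ⟨b, hb⟩ := hBne
    exact dist_nonneg.trans (hy b hb)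
  have hbdd : BddBelow T := ⟨0, hT0⟩
  set ρ := sInf T with hρdef
  have hρ0 : 0 ≤ ρ := le_csInf hTne hT0
  have hρ : ∀ (y : X) (r : ℝ), (∀ b ∈ B, dist y b ≤ r) → ρ ≤ r :=
    fun y r h => csInf_le hbdd ⟨y, h⟩
  have hseq : ∀ n : ℕ, ∃ y : X, ∀ b ∈ B, dist y b ≤ ρ + 1 / ((n : ℝ) + 1) := by
    intro n
    obtain ⟨r, ⟨y, hy⟩, hr⟩ := exists_lt_of_csInf_lt hTne
      (show sInf T < ρ + 1 / ((n : ℝ) + 1) from lt_add_of_pos_right _ (by positivity))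
    exact ⟨y, fun b hb => (hy b hb).trans hr.le⟩
  choose y hy using hseq
  have hcau : CauchySeq y := by
    rw [Metric.cauchySeq_iff']
    intro ε hε
    obtain ⟨η, hη, h⟩ := hX.exists_dist_le_of_almost_minimal hBne hρ0 hρ (half_pos hε)
    obtain ⟨N, hN⟩ := exists_nat_one_div_lt hη
    have hsmall : ∀ n ≥ N, ∀ b ∈ B, dist (y n) b ≤ ρ + η := by
      intro n hn b hb
      refine (hy n b hb).trans ?_
      have : 1 / ((n : ℝ) + 1) ≤ 1 / ((N : ℝ) + 1) := Nat.one_div_le_one_div hn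
      linarith
    exact ⟨N, fun n hn => (h _ _ (hsmall n hn) (hsmall N le_rfl)).trans_lt (half_lt_self hε)⟩
  obtain ⟨c, hc⟩ := cauchySeq_tendsto_of_complete hcau
  have hcB : ∀ b ∈ B, dist c b ≤ ρ := by
    intro b hb
    refine le_of_tendsto_of_tendsto' (hc.dist tendsto_const_nhds) (g := fun n : ℕ => ρ + 1 / ((n : ℝ) + 1))
      ?_ (fun n => hy n b hb)
    simpa using (tendsto_const_nhds (x := ρ)).add tendsto_one_div_add_atTop_nhds_zero_nat
  refine ⟨c, fun g => ?_⟩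
  -- The orbit is invariant, so `g • c` is again a circumcentre; circumcentres are unique.
  have hgB : ∀ b ∈ B, dist (g • c) b ≤ ρ := by
    rintro _ ⟨k, rfl⟩
    have := hcB _ ⟨g⁻¹ * k, rfl⟩
    rwa [← dist_smul g, smul_smul, mul_inv_cancel_left] at this
  refine eq_of_forall_dist_le fun ε hε => ?_
  obtain ⟨η, hη, h⟩ := hX.exists_dist_le_of_almost_minimal hBne hρ0 hρ hε
  exact h _ _ (fun b hb => (hgB b hb).trans (by linarith))
    fun b hb => (hcB b hb).trans (by linarith)

/-- The fixed point set of a group of isometries is closed. -/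
theorem isClosed_fixedPoints_of_isometric : IsClosed (MulAction.fixedPoints Γ X) := by
  simp only [MulAction.fixedPoints, Set.ofPred_forall]
  exact isClosed_iInter fun g => isClosed_eq (continuous_const_smul g) continuous_id

/-- In a uniquely geodesic space, the fixed point set of a group of isometries is convex. -/
theorem IsUniquelyGeodesic.isGeodesicallyConvex_fixedPoints (hX : IsUniquelyGeodesic X) :
    IsGeodesicallyConvex (MulAction.fixedPoints Γ X) := by
  intro x hx y hy γ hγ t ht g
  obtain ⟨γ₀, -, hu⟩ := hX x y
  have hg : IsGeodesic x y fun s => g • γ s := by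
    refine ⟨?_, ?_, fun s hs t ht => ?_⟩
    · simp only [hγ.1]; exact hx g
    · simp only [hγ.2.1]; exact hy g
    · simp only [dist_smul]; exact hγ.2.2 s hs t ht
  exact (hu _ hg ht).trans (hu _ hγ ht).symm

end Circumcenter

/-! ### Fixed point sets as members of the family -/

namespace MetricFamily

variable {F : MetricFamily.{u}}

/-- The fixed point set of a group of isometries of a member of the family is a member, if it is
not empty. -/
theorem fixedPoints_mem (huc : F.ConsistsOfUniformlyConvex)
    (hsub : F.StableUnderClosedConvexSubspaces ∨
      (F.ConsistsOfBanachSpaces ∧ F.StableUnderClosedVectorSubspaces))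
    {X : Type u} [MetricSpace X] (hFX : F X) {Γ : Type v} [Group Γ] [MulAction Γ X]
    [IsIsometricSMul Γ X] (hne : (MulAction.fixedPoints Γ X).Nonempty) :
    F (MulAction.fixedPoints Γ X) := by
  rcases hsub with hsub | ⟨hban, hsub⟩
  · exact hsub X hFX _ hne isClosed_fixedPoints_of_isometric
      (huc X hFX).uniquelyGeodesic.isGeodesicallyConvex_fixedPoints
  · obtain ⟨E, _, _, -, ⟨e⟩⟩ := hban X hFX
    obtain ⟨c, hc⟩ := hne
    -- With the origin moved to a fixed point, Mazur-Ulam makes the action linear, and the fixed set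
    -- becomes a closed vector subspace.
    let e' : X ≃ᵢ E := e.trans (IsometryEquiv.addRight (-e c))
    have he' : e' c = 0 := by simp [e']
    let T : Γ → E ≃ᵢ E := fun g => (e'.symm.trans (IsometryEquiv.constSMul g)).trans e'
    have hT0 : ∀ g, T g 0 = 0 := by
      intro g
      have : e'.symm 0 = c := by rw [← he', e'.symm_apply_apply]
      simp only [T, IsometryEquiv.trans_apply, this, IsometryEquiv.constSMul_apply, hc g, he']
    let L : Γ → E ≃ₗᵢ[ℝ] E := fun g => (T g).toRealLinearIsometryEquivOfMapZero (hT0 g)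
    let V : Submodule ℝ E := ⨅ g, LinearMap.eqLocus (L g).toLinearEquiv.toLinearMap LinearMap.id
    have hV : ∀ v : E, v ∈ V ↔ ∀ g, T g v = v := by
      intro v
      simp only [V, Submodule.mem_iInf, LinearMap.mem_eqLocus]
      rfl
    have hset : e' ⁻¹' (V : Set E) = MulAction.fixedPoints Γ X := by
      ext x
      simp only [Set.mem_preimage, SetLike.mem_coe, hV, MulAction.mem_fixedPoints, T,
        IsometryEquiv.trans_apply, e'.symm_apply_apply, IsometryEquiv.constSMul_apply,
        e'.injective.eq_iff]
    have hVc : IsClosed (V : Set E) := by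
      have : (V : Set E) = ⋂ g, {v | T g v = v} := by
        ext v
        simp [hV]
      rw [this]
      exact isClosed_iInter fun g => isClosed_eq (T g).continuous continuous_id
    have := hsub X hFX E e' V hVc
    rwa [hset] at this

end MetricFamily

/-! ### Short relations -/

section ShortRelations

variable {α : Type v}

/-- Elements of the free group that are represented by words of length at most `n`. -/
def IsShort (n : ℕ) (r : FreeGroup α) : Prop :=
  ∃ w : List (α × Bool), w.length ≤ n ∧ FreeGroup.mk w = r

theorem IsShort.mul {m n : ℕ} {a b : FreeGroup α} (ha : IsShort m a)
    (hb : IsShort n b) : IsShort (m + n) (a * b) := by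
  obtain ⟨v, hv, rfl⟩ := ha
  obtain ⟨w, hw, rfl⟩ := hb
  exact ⟨v ++ w, by simpa using add_le_add hv hw, by simp⟩

theorem IsShort.inv {n : ℕ} {a : FreeGroup α} (ha : IsShort n a) : IsShort n a⁻¹ := by
  obtain ⟨v, hv, rfl⟩ := ha
  exact ⟨FreeGroup.invRev v, by simpa using hv, by simp⟩

theorem IsShort.mono {m n : ℕ} (h : m ≤ n) {a : FreeGroup α} (ha : IsShort m a) :
    IsShort n a := by
  obtain ⟨v, hv, rfl⟩ := ha
  exact ⟨v, hv.trans h, rfl⟩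

theorem exists_isShort (a : FreeGroup α) : ∃ n, IsShort n a := by
  classical exact ⟨_, a.toWord, le_rfl, FreeGroup.mk_toWord⟩

variable {G : Type v} (S : Set G)

open Classical in
/-- An element of `S` as a letter; elements outside `S` are sent to `1`. -/
noncomputable def letter (g : G) : FreeGroup S := if h : g ∈ S then FreeGroup.of ⟨g, h⟩ else 1

variable {S}

theorem letter_of_mem {g : G} (h : g ∈ S) : letter S g = FreeGroup.of ⟨g, h⟩ := dif_pos h

theorem letter_of_notMem {g : G} (h : g ∉ S) : letter S g = 1 := dif_neg h

theorem isShort_letter (g : G) : IsShort 1 (letter S g) := by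
  by_cases h : g ∈ S
  · rw [letter_of_mem h]
    exact ⟨[(⟨g, h⟩, true)], by simp, rfl⟩
  · rw [letter_of_notMem h]
    exact ⟨[], by simp, rfl⟩

variable [Group G] (S)

/-- The evaluation of words in `S`. -/
abbrev evalWord : FreeGroup S →* G := FreeGroup.lift fun s : S => (s : G)

/-- The relations in `G` between elements of `S` of length at most `n`. -/
def shortRelations (n : ℕ) : Set (FreeGroup S) := {r | evalWord S r = 1 ∧ IsShort n r}

variable {S}

theorem evalWord_letter {g : G} (h : g ∈ S) : evalWord S (letter S g) = g := by
  rw [letter_of_mem h]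
  simp

theorem surjective_evalWord (h : Subgroup.closure S = ⊤) : Function.Surjective (evalWord S) := by
  rw [← MonoidHom.range_eq_top, FreeGroup.range_lift_eq_closure]
  simpa using h

variable {H : Type*} [Group H] {f : FreeGroup S →* H} {n : ℕ}

/-- The word `a · b · (ab)⁻¹` is a relation of length 3; only conjugation needs length 4. The map
`f` is arbitrary because this serves both the quotient map and the actions on the spaces. -/
theorem map_letter_mul (hf : ∀ r ∈ shortRelations S n, f r = 1) (hn : 4 ≤ n) {a b : G}
    (ha : a ∈ S) (hb : b ∈ S) (hab : a * b ∈ S) :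
    f (letter S (a * b)) = f (letter S a) * f (letter S b) := by
  have := hf ((letter S a * letter S b) * (letter S (a * b))⁻¹) ⟨?_, ?_⟩
  · rw [map_mul, map_inv, mul_inv_eq_one, map_mul] at this
    exact this.symm
  · simp only [map_mul, map_inv, evalWord_letter, ha, hb, hab, mul_inv_cancel]
  · exact (((isShort_letter _).mul (isShort_letter _)).mul (isShort_letter _).inv).mono (by omega)

/-- For `1 ∈ S` the letter of `1` is a free generator, not the empty word; the relation `1 · 1 = 1`
kills it. -/
theorem map_letter_one (hf : ∀ r ∈ shortRelations S n, f r = 1) (hn : 4 ≤ n)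
    (h1 : (1 : G) ∈ S) : f (letter S (1 : G)) = 1 := by
  have := map_letter_mul hf hn h1 h1 (by rwa [one_mul])
  rw [one_mul] at this
  simpa using this

theorem map_letter_inv (hf : ∀ r ∈ shortRelations S n, f r = 1) (hn : 4 ≤ n)
    (h1 : (1 : G) ∈ S) {a : G} (ha : a ∈ S) (ha' : a⁻¹ ∈ S) :
    f (letter S a⁻¹) = (f (letter S a))⁻¹ := by
  rw [eq_inv_iff_mul_eq_one, ← map_letter_mul hf hn ha' ha (by rwa [inv_mul_cancel]),
    inv_mul_cancel, map_letter_one hf hn h1]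

theorem map_letter_conj (hf : ∀ r ∈ shortRelations S n, f r = 1) (hn : 4 ≤ n) {a b : G}
    (ha : a ∈ S) (hb : b ∈ S) (hab : a * b * a⁻¹ ∈ S) :
    f (letter S (a * b * a⁻¹)) = f (letter S a) * f (letter S b) * (f (letter S a))⁻¹ := by
  have := hf ((letter S a * letter S b * (letter S a)⁻¹) * (letter S (a * b * a⁻¹))⁻¹) ⟨?_, ?_⟩
  · rw [map_mul, map_inv, mul_inv_eq_one, map_mul, map_mul, map_inv] at this
    exact this.symm
  · simp only [map_mul, map_inv, evalWord_letter, ha, hb, hab, mul_inv_cancel]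
  · exact ((((isShort_letter _).mul (isShort_letter _)).mul (isShort_letter _).inv).mul
      (isShort_letter _).inv).mono (by omega)

end ShortRelations

/-! ### Neighbourhoods of the identity adapted to a compact set -/

section Neighbourhoods

variable {G : Type v} [Group G] [TopologicalSpace G] [IsTopologicalGroup G]

/-- Given a compact set `K`, every neighbourhood `W` of the identity contains the products, the
inverses and the conjugates by `K` of the elements of a smaller neighbourhood. -/
theorem exists_nhds_one_adapted {K W : Set G} (hK : IsCompact K) (hW : W ∈ 𝓝 (1 : G)) :
    ∃ V ∈ 𝓝 (1 : G), V⁻¹ = V ∧ (∀ a ∈ V, ∀ b ∈ V, a * b ∈ W) ∧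
      ∀ s ∈ K, ∀ a ∈ V, s * a * s⁻¹ ∈ W := by
  obtain ⟨V₁, hV₁, -, h₁, hmul⟩ := exists_closed_nhds_one_inv_eq_mul_subset hW
  -- Every conjugate of `1` is `1`, and compactness of `K` makes the neighbourhood uniform in `s`.
  have hconj : ∀ᶠ a in 𝓝 (1 : G), ∀ s ∈ K, s * a * s⁻¹ ∈ W := by
    refine hK.eventually_forall_of_forall_eventually fun s _ => ?_
    have hc : Continuous fun p : G × G => p.2 * p.1 * p.2⁻¹ := by fun_prop
    refine hc.continuousAt.eventually_mem ?_
    simpa using hW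
  refine ⟨V₁ ∩ ({a | ∀ s ∈ K, s * a * s⁻¹ ∈ W} ∩ {a | ∀ s ∈ K, s * a * s⁻¹ ∈ W}⁻¹),
    inter_mem hV₁ (inter_mem hconj (inv_mem_nhds_one G hconj)), ?_, ?_, ?_⟩
  · rw [Set.inter_inv, Set.inter_inv, inv_inv, h₁, Set.inter_comm {a | _}⁻¹]
  · exact fun a ha b hb => hmul (Set.mul_mem_mul ha.1 hb.1)
  · exact fun s hs a ha => ha.2.1 s hs

/-- A compactly generated locally compact group is generated by a compact symmetric neighbourhood
of the identity. -/
theorem IsCompactlyGenerated.exists_symmetric_nhds [LocallyCompactSpace G]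
    (hG : IsCompactlyGenerated G) :
    ∃ S : Set G, IsCompact S ∧ S ∈ 𝓝 (1 : G) ∧ (∀ s ∈ S, s⁻¹ ∈ S) ∧ Subgroup.closure S = ⊤ := by
  obtain ⟨K, hK, hKc⟩ := hG
  obtain ⟨W, hW, hW1⟩ := exists_compact_mem_nhds (1 : G)
  refine ⟨(K ∪ W) ∪ (K ∪ W)⁻¹, (hK.union hW).union (hK.union hW).inv, ?_, ?_, ?_⟩
  · filter_upwards [hW1] with g hg using Or.inl (Or.inr hg)
  · rintro s (hs | hs)
    · exact Or.inr (by simpa using hs)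
    · exact Or.inl hs
  · rw [eq_top_iff, ← hKc]
    exact Subgroup.closure_mono fun g hg => Or.inl (Or.inl hg)

end Neighbourhoods

/-! ### The group presented by the short relations -/

section TruncatedGroup

variable {G : Type v} [Group G] (S : Set G) (n : ℕ)

/-- The group with generators `S` and the relations of `G` of length at most `n`. -/
abbrev TruncatedGroup : Type v := FreeGroup S ⧸ Subgroup.normalClosure (shortRelations S n)

namespace TruncatedGroup

/-- The quotient map from the free group. -/
abbrev ofWord : FreeGroup S →* TruncatedGroup S n := QuotientGroup.mk' _

theorem ofWord_shortRelations (r : FreeGroup S) (hr : r ∈ shortRelations S n) :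
    ofWord S n r = 1 :=
  (QuotientGroup.eq_one_iff r).2 (Subgroup.subset_normalClosure hr)

/-- The canonical map to `G`. -/
noncomputable def toGroup : TruncatedGroup S n →* G :=
  QuotientGroup.lift _ (evalWord S) (by
    have : Subgroup.normalClosure (shortRelations S n) ≤ (evalWord S).ker :=
      Subgroup.normalClosure_le_normal fun r hr => hr.1
    exact this)

/-- The image of an element of `S`. -/
noncomputable def incl (g : G) : TruncatedGroup S n := ofWord S n (letter S g)

variable {S n}

theorem toGroup_ofWord (a : FreeGroup S) : toGroup S n (ofWord S n a) = evalWord S a := rfl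

theorem toGroup_incl {g : G} (hg : g ∈ S) : toGroup S n (incl S n g) = g := by
  rw [incl, toGroup_ofWord, evalWord_letter hg]

theorem surjective_toGroup (h : Subgroup.closure S = ⊤) :
    Function.Surjective (toGroup S n) := fun g => by
  obtain ⟨a, rfl⟩ := surjective_evalWord h g
  exact ⟨ofWord S n a, rfl⟩

variable (S n) in
theorem closure_incl_image : Subgroup.closure (incl S n '' S) = ⊤ := by
  rw [eq_top_iff]
  rintro q -
  obtain ⟨a, rfl⟩ := QuotientGroup.mk'_surjective _ q
  induction a using FreeGroup.induction_on with
  | C1 => simp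
  | of s =>
    refine Subgroup.subset_closure ⟨s, s.2, ?_⟩
    rw [incl, letter_of_mem s.2]
  | inv_of s h => rw [map_inv]; exact inv_mem h
  | mul a b ha hb => rw [map_mul]; exact mul_mem ha hb

variable [TopologicalSpace G] [IsTopologicalGroup G]

/-- The images of the neighbourhoods of the identity contained in `S` form a basis of
neighbourhoods of the identity of a group topology. -/
@[reducible]
noncomputable def filterBasis (hn : 4 ≤ n) (hS : S ∈ 𝓝 (1 : G)) (hinv : ∀ s ∈ S, s⁻¹ ∈ S) :
    GroupFilterBasis (TruncatedGroup S n) where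
  sets := {A | ∃ W ∈ 𝓝 (1 : G), W ⊆ S ∧ incl S n '' W = A}
  nonempty := ⟨_, S, hS, subset_rfl, rfl⟩
  inter_sets := by
    rintro _ _ ⟨V, hV, hVS, rfl⟩ ⟨W, hW, -, rfl⟩
    exact ⟨_, ⟨V ∩ W, inter_mem hV hW, fun g hg => hVS hg.1, rfl⟩, Set.image_inter_subset _ _ _⟩
  one' := by
    rintro _ ⟨W, hW, -, rfl⟩
    exact ⟨1, mem_of_mem_nhds hW,
      map_letter_one (ofWord_shortRelations S n) hn (mem_of_mem_nhds hS)⟩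
  mul' := by
    rintro _ ⟨W, hW, hWS, rfl⟩
    obtain ⟨V, hV, -, hmul, -⟩ := exists_nhds_one_adapted isCompact_empty hW
    refine ⟨_, ⟨V ∩ S, inter_mem hV hS, Set.inter_subset_right, rfl⟩, ?_⟩
    rintro _ ⟨_, ⟨a, ha, rfl⟩, _, ⟨b, hb, rfl⟩, rfl⟩
    have hab := hmul a ha.1 b hb.1
    exact ⟨a * b, hab, map_letter_mul (ofWord_shortRelations S n) hn ha.2 hb.2 (hWS hab)⟩
  inv' := by
    rintro _ ⟨W, hW, hWS, rfl⟩
    refine ⟨_, ⟨W⁻¹ ∩ S, inter_mem (inv_mem_nhds_one G hW) hS, Set.inter_subset_right, rfl⟩, ?_⟩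
    rintro _ ⟨a, ha, rfl⟩
    exact ⟨a⁻¹, ha.1, map_letter_inv (ofWord_shortRelations S n) hn (mem_of_mem_nhds hS) ha.2
      (hinv a ha.2)⟩
  conj' := by
    intro q
    obtain ⟨a, rfl⟩ := QuotientGroup.mk'_surjective _ q
    -- Conjugation by letters suffices: inverses of letters are letters up to short relations, and
    -- the condition composes along products.
    have hlet : ∀ s ∈ S, ∀ {A : Set (TruncatedGroup S n)},
        (∃ W ∈ 𝓝 (1 : G), W ⊆ S ∧ incl S n '' W = A) →
        ∃ B ∈ {A | ∃ W ∈ 𝓝 (1 : G), W ⊆ S ∧ incl S n '' W = A},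
          B ⊆ (fun x => incl S n s * x * (incl S n s)⁻¹) ⁻¹' A := by
      rintro s hs _ ⟨W, hW, hWS, rfl⟩
      obtain ⟨V, hV, -, -, hconj⟩ := exists_nhds_one_adapted (isCompact_singleton (x := s)) hW
      refine ⟨_, ⟨V ∩ S, inter_mem hV hS, Set.inter_subset_right, rfl⟩, ?_⟩
      rintro _ ⟨b, hb, rfl⟩
      have hsb := hconj s rfl b hb.1
      exact ⟨_, hsb, map_letter_conj (ofWord_shortRelations S n) hn hs hb.2 (hWS hsb)⟩
    induction a using FreeGroup.induction_on with
    | C1 => exact fun {A} hA => ⟨A, hA, by simp⟩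
    | of s =>
      have := @hlet s s.2
      rwa [incl, letter_of_mem s.2] at this
    | inv_of s _ =>
      have := @hlet _ (hinv s s.2)
      rwa [incl, map_letter_inv (ofWord_shortRelations S n) hn (mem_of_mem_nhds hS) s.2
        (hinv s s.2), letter_of_mem s.2, ← map_inv] at this
    | mul a b ha hb =>
      intro A hA
      obtain ⟨B, hB, hBA⟩ := ha hA
      obtain ⟨C, hC, hCB⟩ := hb hB
      refine ⟨C, hC, fun x hx => ?_⟩
      have := hBA (hCB hx)
      simpa [mul_assoc] using this

end TruncatedGroup

end TruncatedGroup

/-! ### Topology and compact presentation of the truncated group -/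

section TruncatedGroupTopology

variable {G : Type v} [Group G] {S : Set G} {n : ℕ}

namespace TruncatedGroup

section

variable [TopologicalSpace G] [IsTopologicalGroup G]

/-- A group topology on the truncated group for which the canonical map to `G` is a local
homeomorphism. -/
theorem exists_topology [T2Space G] (hn : 4 ≤ n) (hSc : IsCompact S) (hS : S ∈ 𝓝 (1 : G))
    (hinv : ∀ s ∈ S, s⁻¹ ∈ S) :
    ∃ (_ : TopologicalSpace (TruncatedGroup S n)) (_ : IsTopologicalGroup (TruncatedGroup S n))
      (_ : T2Space (TruncatedGroup S n)) (_ : LocallyCompactSpace (TruncatedGroup S n)),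
      ContinuousOn (incl S n) S ∧ Continuous (toGroup S n) ∧
        DiscreteTopology (toGroup S n).ker := by
  set B := filterBasis hn hS hinv with hB
  let _ : TopologicalSpace (TruncatedGroup S n) := B.topology
  have hgrp : IsTopologicalGroup (TruncatedGroup S n) := B.isTopologicalGroup
  have hbasis := B.nhds_one_hasBasis
  have hmem : ∀ W ∈ 𝓝 (1 : G), W ⊆ S → incl S n '' W ∈ 𝓝 (1 : TruncatedGroup S n) :=
    fun W hW hWS => B.mem_nhds_one ⟨W, hW, hWS, rfl⟩
  -- The neighbourhood `incl S n '' S` meets the kernel only in `1`; this gives both the Hausdorff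
  -- property and discreteness of the kernel.
  have hkey : ∀ q ∈ incl S n '' S, toGroup S n q = 1 → q = 1 := by
    rintro _ ⟨g, hg, rfl⟩ h
    rw [toGroup_incl hg] at h
    rw [h]
    exact map_letter_one (ofWord_shortRelations S n) hn (mem_of_mem_nhds hS)
  have ht2 : T2Space (TruncatedGroup S n) := by
    rw [B.t2Space_iff_sInter_subset rfl]
    intro q hq
    refine hkey q (hq _ ⟨S, hS, subset_rfl, rfl⟩) ?_
    by_contra hne
    have hW : S ∩ {toGroup S n q}ᶜ ∈ 𝓝 (1 : G) :=
      inter_mem hS (isOpen_compl_singleton.mem_nhds (by simpa [eq_comm] using hne))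
    obtain ⟨g, hg, hgq⟩ := hq _ ⟨_, hW, Set.inter_subset_left, rfl⟩
    have := toGroup_incl (n := n) hg.1
    rw [hgq] at this
    exact hg.2 this.symm
  have hcont : ContinuousOn (incl S n) S := by
    intro s hs
    rw [ContinuousWithinAt, (B.nhds_hasBasis _).tendsto_right_iff]
    rintro _ ⟨W, hW, hWS, rfl⟩
    have hev : ∀ᶠ t in 𝓝 s, s⁻¹ * t ∈ W := by
      have hc : Continuous fun t : G => s⁻¹ * t := by fun_prop
      refine hc.continuousAt.eventually_mem ?_
      simpa using hW
    filter_upwards [mem_nhdsWithin_of_mem_nhds hev, self_mem_nhdsWithin] with t ht htS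
    refine ⟨_, ⟨_, ht, rfl⟩, ?_⟩
    have := map_letter_mul (ofWord_shortRelations S n) hn hs (hWS ht)
      (by rwa [mul_inv_cancel_left])
    rw [mul_inv_cancel_left] at this
    exact this.symm
  have hlc : LocallyCompactSpace (TruncatedGroup S n) :=
    (hSc.image_of_continuousOn hcont).locallyCompactSpace_of_mem_nhds_of_group
      (hmem S hS subset_rfl)
  have hto : Continuous (toGroup S n) := by
    refine continuous_of_continuousAt_one _ ?_
    intro W hW
    rw [map_one] at hW
    refine mem_map.2 (mem_of_superset (hmem (W ∩ S) (inter_mem hW hS) Set.inter_subset_right) ?_)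
    rintro _ ⟨g, hg, rfl⟩
    rw [Set.mem_preimage, toGroup_incl hg.2]
    exact hg.1
  refine ⟨inferInstance, hgrp, ht2, hlc, hcont, hto, ?_⟩
  rw [discreteTopology_iff_isOpen_singleton_one, isOpen_singleton_iff_nhds_eq_pure,
    nhds_subtype_eq_comap]
  refine le_antisymm ?_ (by
    rw [← nhds_subtype_eq_comap]
    exact pure_le_nhds _)
  rw [le_pure_iff]
  refine ⟨_, hmem S hS subset_rfl, ?_⟩
  rintro ⟨q, hq⟩ hqS
  exact Subtype.ext (hkey q hqS hq)

end

/-- The truncated group is compactly presented. -/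
theorem isCompactlyPresented [TopologicalSpace (TruncatedGroup S n)]
    (hc : IsCompact (incl S n '' S)) : IsCompactlyPresented (TruncatedGroup S n) := by
  -- A compact presentation needs generators inside the group itself, so the letters are relabelled
  -- by their images; `toGroup` inverts `incl` on `S`.
  let e : S ≃ (incl S n '' S : Set _) := Equiv.Set.imageOfInjOn (incl S n) S fun a ha b hb hab => by
    simpa only [toGroup_incl ha, toGroup_incl hb] using congrArg (toGroup S n) hab
  let E : FreeGroup S ≃* FreeGroup (incl S n '' S : Set _) := FreeGroup.freeGroupCongr e
  refine ⟨incl S n '' S, hc, closure_incl_image S n, E '' shortRelations S n, n, ?_, ?_⟩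
  · rintro _ ⟨r, ⟨-, w, hw, rfl⟩, rfl⟩
    exact ⟨w.map fun x => (e x.1, x.2), by simpa using hw, FreeGroup.map.mk.symm⟩
  · have hcomp : (FreeGroup.lift fun s : (incl S n '' S : Set _) => (s : TruncatedGroup S n)).comp
        E.toMonoidHom = ofWord S n := by
      ext s
      simp only [E, e, MonoidHom.comp_apply, MulEquiv.toMonoidHom_eq_coe, MonoidHom.coe_coe,
        FreeGroup.freeGroupCongr_apply, FreeGroup.map.of, FreeGroup.lift_apply_of]
      change incl S n s = _
      rw [incl, letter_of_mem s.2]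
    have h1 : Subgroup.normalClosure (E '' shortRelations S n) =
        (Subgroup.normalClosure (shortRelations S n)).map E.toMonoidHom :=
      (Subgroup.map_normalClosure _ E.toMonoidHom E.surjective).symm
    have h2 : Subgroup.normalClosure (shortRelations S n) = (ofWord S n).ker :=
      (QuotientGroup.ker_mk' _).symm
    refine h1.trans ((congrArg (Subgroup.map E.toMonoidHom) (h2.trans ?_)).trans
      (Subgroup.map_comap_eq_self_of_surjective E.surjective _))
    rw [MonoidHom.comap_ker]
    exact congrArg MonoidHom.ker hcomp.symm

end TruncatedGroup

end TruncatedGroupTopology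

/-! ### Almost minimal displacement -/

section Displacement

variable {X : Type u} [MetricSpace X]

/-- If `D` is a positive continuous function on a complete metric space, then there are points at
which `D` is minimal up to a factor `2` on a ball of radius proportional to its value. -/
theorem exists_almost_minimal [CompleteSpace X] [Nonempty X] {D : X → ℝ} (hD : Continuous D)
    (hpos : ∀ x, 0 < D x) {N : ℝ} (hN : 0 < N) :
    ∃ x, ∀ y, dist x y ≤ N * D x → D x / 2 ≤ D y := by
  by_contra! h
  choose f hf hfD using h
  obtain ⟨x₀⟩ := ‹Nonempty X›
  -- Each step halves `D` and has length at most `N * D`, so the sequence converges to a point where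
  -- `D` would be at most `0`.
  let x : ℕ → X := fun k => f^[k] x₀
  have hx : ∀ k, x (k + 1) = f (x k) := fun k => Function.iterate_succ_apply' f k x₀
  have hDx : ∀ k, D (x k) ≤ D x₀ / 2 ^ k := by
    intro k
    induction k with
    | zero => simp [x]
    | succ k ih =>
      have h1 := hfD (x k)
      rw [← hx] at h1
      rw [pow_succ, ← div_div]
      linarith
  have hdist : ∀ k, dist (x k) (x (k + 1)) ≤ 2 * (N * D x₀) / 2 / 2 ^ k := by
    intro k
    rw [hx]
    refine (hf (x k)).trans ?_
    calc N * D (x k) ≤ N * (D x₀ / 2 ^ k) := by gcongr; exact hDx k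
      _ = 2 * (N * D x₀) / 2 / 2 ^ k := by ring
  obtain ⟨c, hc⟩ := cauchySeq_tendsto_of_complete (cauchySeq_of_le_geometric_two hdist)
  have h1 : Tendsto (fun k => D (x k)) atTop (𝓝 (D c)) := (hD.tendsto c).comp hc
  have h2 : Tendsto (fun k : ℕ => D x₀ / 2 ^ k) atTop (𝓝 0) := by
    have := (tendsto_pow_atTop_nhds_zero_of_lt_one (r := (1 / 2 : ℝ)) (by norm_num)
      (by norm_num)).const_mul (D x₀)
    simpa [div_eq_mul_inv] using this
  exact absurd (le_of_tendsto_of_tendsto' h1 h2 hDx) (not_le.2 (hpos c))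

/-- If a group acts isometrically without fixed points, a generating set `T` with bounded orbits
moves, after rescaling, some point by at most `1` and all points of a large ball around it by a
definite amount. -/
theorem exists_rescaled_displacement [CompleteSpace X] [Nonempty X] {H : Type v} [Group H]
    [MulAction H X] [IsIsometricSMul H X] (hfix : ∀ x : X, ∃ g : H, g • x ≠ x) {T : Set H}
    (hT : Subgroup.closure T = ⊤) (hbdd : ∀ x : X, BddAbove ((fun g : H => dist (g • x) x) '' T))
    {N : ℝ} (hN : 0 < N) :
    ∃ (x : X) (l : ℝ≥0), 0 < l ∧ (∀ g ∈ T, l * dist (g • x) x ≤ 1) ∧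
      ∀ y, l * dist x y ≤ N → ∃ g ∈ T, 1 / 4 ≤ l * dist (g • y) y := by
  have hmove : ∀ x : X, ∃ g ∈ T, g • x ≠ x := by
    intro x
    by_contra! h
    obtain ⟨g, hg⟩ := hfix x
    have : Subgroup.closure T ≤ MulAction.stabilizer H x :=
      (Subgroup.closure_le _).2 fun g hg => h g hg
    rw [hT] at this
    exact hg (this (Subgroup.mem_top g))
  have hTne : T.Nonempty := by
    obtain ⟨g, hg, -⟩ := hmove (Classical.arbitrary X)
    exact ⟨g, hg⟩
  let D : X → ℝ := fun x => sSup ((fun g : H => dist (g • x) x) '' T)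
  have hle : ∀ x, ∀ g ∈ T, dist (g • x) x ≤ D x := fun x g hg => le_csSup (hbdd x) ⟨g, hg, rfl⟩
  have hpos : ∀ x, 0 < D x := by
    intro x
    obtain ⟨g, hg, hgx⟩ := hmove x
    exact (dist_pos.2 hgx).trans_le (hle x g hg)
  have hcont : Continuous D := by
    refine (LipschitzWith.of_le_add_mul 2 fun x y => ?_).continuous
    refine csSup_le (hTne.image _) ?_
    rintro _ ⟨g, hg, rfl⟩
    have h1 := dist_triangle4 (g • x) (g • y) y x
    have h2 := hle y g hg
    rw [dist_smul, dist_comm y x] at h1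
    simp only [NNReal.coe_ofNat]
    linarith
  obtain ⟨x, hx⟩ := exists_almost_minimal hcont hpos hN
  have hlpos : 0 < D x := hpos x
  refine ⟨x, ⟨(D x)⁻¹, (inv_pos.2 hlpos).le⟩, inv_pos.2 hlpos, fun g hg => ?_, fun y hy => ?_⟩
  · change (D x)⁻¹ * _ ≤ 1
    rw [inv_mul_le_one₀ hlpos]
    exact hle x g hg
  · change (D x)⁻¹ * _ ≤ N at hy
    rw [inv_mul_le_iff₀ hlpos, mul_comm] at hy
    -- The supremum `D y ≥ D x / 2` need not be attained, hence `1 / 4` in place of `1 / 2`.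
    have h1 : D x / 4 < D y := lt_of_lt_of_le (by linarith) (hx y hy)
    obtain ⟨_, ⟨g, hg, rfl⟩, h2⟩ := exists_lt_of_lt_csSup (hTne.image _) h1
    refine ⟨g, hg, ?_⟩
    change 1 / 4 ≤ (D x)⁻¹ * _
    rw [le_inv_mul_iff₀ hlpos]
    linarith

end Displacement

/-! ### Families of isometries acting on an ultraproduct -/

section BoundedIsometries

instance {M : Type v} [Group M] {Y : Type u} [MetricSpace Y] [MulAction M Y]
    [IsIsometricSMul M Y] (H : Subgroup M) : IsIsometricSMul H Y :=
  ⟨fun h => isometry_smul Y (h : M)⟩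

variable {I : Type u} (U : Ultrafilter I) (X : I → Type u) [∀ i, MetricSpace (X i)]
    (l : I → ℝ≥0) (x : ∀ i, X i)

/-- The families of isometries that move the base points by a bounded amount. -/
def boundedIsometries : Subgroup (∀ i, X i ≃ᵢ X i) where
  carrier := {g | ∃ C : ℝ, ∀ i, (l i : ℝ) * dist (g i (x i)) (x i) ≤ C}
  one_mem' := ⟨0, fun i => by simp⟩
  mul_mem' := by
    rintro g h ⟨C, hC⟩ ⟨D, hD⟩
    refine ⟨D + C, fun i => ?_⟩
    calc (l i : ℝ) * dist (g i (h i (x i))) (x i)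
        ≤ l i * (dist (g i (h i (x i))) (g i (x i)) + dist (g i (x i)) (x i)) := by
          gcongr; exact dist_triangle _ _ _
      _ = l i * dist (h i (x i)) (x i) + l i * dist (g i (x i)) (x i) := by
          rw [(g i).dist_eq, mul_add]
      _ ≤ D + C := add_le_add (hD i) (hC i)
  inv_mem' := by
    rintro g ⟨C, hC⟩
    refine ⟨C, fun i => ?_⟩
    have : dist ((g i)⁻¹ (x i)) (x i) = dist (g i (x i)) (x i) := by
      rw [← (g i).dist_eq, IsometryEquiv.apply_inv_self, dist_comm]
    rw [Pi.inv_apply, this]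
    exact hC i

variable {X l x}

instance : MulAction (boundedIsometries X l x) (PreUltraproduct U X l x) where
  smul g y := ⟨fun i => g.1 i (y.1 i), by
    obtain ⟨C, hC⟩ := g.2
    obtain ⟨D, hD⟩ := y.2
    refine ⟨C + D, fun i => ?_⟩
    calc (l i : ℝ) * dist (x i) (g.1 i (y.1 i))
        ≤ l i * (dist (x i) (g.1 i (x i)) + dist (g.1 i (x i)) (g.1 i (y.1 i))) := by
          gcongr; exact dist_triangle _ _ _
      _ = l i * dist (g.1 i (x i)) (x i) + l i * dist (x i) (y.1 i) := by
          rw [(g.1 i).dist_eq, mul_add, dist_comm (x i) (g.1 i (x i))]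
      _ ≤ C + D := add_le_add (hC i) (hD i)⟩
  one_smul _ := rfl
  mul_smul _ _ _ := rfl

variable {U}

theorem boundedIsometries.smul_val (g : boundedIsometries X l x) (y : PreUltraproduct U X l x)
    (i : I) : (g • y).1 i = g.1 i (y.1 i) := rfl

instance : IsIsometricSMul (boundedIsometries X l x) (PreUltraproduct U X l x) where
  isometry_smul g := Isometry.of_dist_eq fun y z => by
    refine tendsto_nhds_unique (PreUltraproduct.tendsto_dist (g • y) (g • z)) ?_
    simpa only [boundedIsometries.smul_val, IsometryEquiv.dist_eq] using
      PreUltraproduct.tendsto_dist y z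

instance : IsIsometricSMul (boundedIsometries X l x) (RescaledUltraproduct U X l x) where
  isometry_smul g := Isometry.of_dist_eq fun y z => by
    obtain ⟨y, rfl⟩ := SeparationQuotient.surjective_mk y
    obtain ⟨z, rfl⟩ := SeparationQuotient.surjective_mk z
    exact dist_smul g y z

/-- The distance between a point of the ultraproduct and its image under a family of isometries. -/
theorem boundedIsometries.tendsto_dist_smul (g : boundedIsometries X l x)
    (y : PreUltraproduct U X l x) :
    Tendsto (fun i => (l i : ℝ) * dist (g.1 i (y.1 i)) (y.1 i)) (U : Filter I)
      (𝓝 (dist (g • (SeparationQuotient.mk y : RescaledUltraproduct U X l x))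
        (SeparationQuotient.mk y))) :=
  PreUltraproduct.tendsto_dist (g • y) y

end BoundedIsometries

/-! ### Sequences of actions of truncated groups -/

section ApproximateAction

variable {G : Type v} [Group G]

/-- A decreasing sequence of neighbourhoods of the identity in `S` whose intersection is a normal
subgroup. -/
structure AdaptedNhds [TopologicalSpace G] (S : Set G) where
  /-- The neighbourhoods. -/
  V : ℕ → Set G
  mem_nhds : ∀ k, V k ∈ 𝓝 (1 : G)
  subset : ∀ k, V k ⊆ S
  antitone : Antitone V
  inv_mem : ∀ k, ∀ a ∈ V k, a⁻¹ ∈ V k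
  mul_mem : ∀ k, ∀ a ∈ V (k + 1), ∀ b ∈ V (k + 1), a * b ∈ V k
  conj_mem : ∀ k, ∀ s ∈ S, ∀ a ∈ V (k + 1), s * a * s⁻¹ ∈ V k

/-- Iterates `exists_nhds_one_adapted`. The sequence need not be a neighbourhood basis, so `G` need
not be metrizable. -/
theorem AdaptedNhds.nonempty [TopologicalSpace G] [IsTopologicalGroup G] {S : Set G}
    (hSc : IsCompact S) (hS : S ∈ 𝓝 (1 : G)) (hinv : ∀ s ∈ S, s⁻¹ ∈ S) :
    Nonempty (AdaptedNhds S) := by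
  choose! f hf hfinv hfmul hfconj using fun (W : Set G) (hW : W ∈ 𝓝 (1 : G)) =>
    exists_nhds_one_adapted hSc hW
  let V : ℕ → Set G := fun k => f^[k] (S ∩ S⁻¹)
  have hsucc : ∀ k, V (k + 1) = f (V k) := fun k => Function.iterate_succ_apply' f k _
  have hmem : ∀ k, V k ∈ 𝓝 (1 : G) := by
    intro k
    induction k with
    | zero => exact inter_mem hS (inv_mem_nhds_one G hS)
    | succ k ih => rw [hsucc]; exact hf _ ih
  have hanti : Antitone V := antitone_nat_of_succ_le fun k a ha => by
    have := hfmul _ (hmem k) a (by rwa [← hsucc]) 1 (by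
      rw [← hsucc]; exact mem_of_mem_nhds (hmem (k + 1)))
    rwa [mul_one] at this
  refine ⟨⟨V, hmem, fun k => (hanti (Nat.zero_le k)).trans Set.inter_subset_left, hanti, ?_, ?_,
    ?_⟩⟩
  · intro k a ha
    cases k with
    | zero => exact ⟨hinv a ha.1, by simpa using ha.1⟩
    | succ k =>
      rw [hsucc] at ha ⊢
      rwa [← hfinv _ (hmem k), Set.inv_mem_inv]
  · intro k a ha b hb
    rw [hsucc] at ha hb
    exact hfmul _ (hmem k) a ha b hb
  · intro k s hs a ha
    rw [hsucc] at ha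
    exact hfconj _ (hmem k) s hs a ha

/-- A sequence of isometric actions of the free group on `S`, in which more and more relations of
`G` are respected, with base points that `S` moves by a bounded amount after rescaling. -/
structure ApproximateAction (S : Set G) where
  /-- The spaces. -/
  X : ULift.{u} ℕ → Type u
  /-- The metrics. -/
  metric : ∀ i, MetricSpace (X i)
  /-- The actions. -/
  act : ∀ i, FreeGroup S →* (X i ≃ᵢ X i)
  /-- The rescaling factors. -/
  scale : ULift.{u} ℕ → ℝ≥0
  /-- The base points. -/
  base : ∀ i, X i
  act_relation : ∀ i, ∀ r ∈ shortRelations S (i.down + 4), act i r = 1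
  bound : ∀ i (s : S), (scale i : ℝ) * dist (act i (FreeGroup.of s) (base i)) (base i) ≤ 1

attribute [instance] ApproximateAction.metric

/-- A non-principal ultrafilter on the natural numbers. -/
noncomputable abbrev natUltrafilter : Ultrafilter (ULift.{u} ℕ) := hyperfilter (ULift.{u} ℕ)

theorem eventually_le_natUltrafilter (k : ℕ) :
    ∀ᶠ i : ULift.{u} ℕ in (natUltrafilter : Filter (ULift.{u} ℕ)), k ≤ i.down := by
  refine hyperfilter_le_cofinite ?_
  have : {i : ULift.{u} ℕ | i.down < k}.Finite :=
    (Set.finite_lt_nat k).preimage ULift.down_injective.injOn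
  refine mem_cofinite.2 (this.subset fun i hi => ?_)
  simpa using hi

namespace ApproximateAction

variable {S : Set G} (A : ApproximateAction.{u} S)

/-- The bounded families of isometries. -/
abbrev Isometries : Type u := boundedIsometries A.X A.scale A.base

/-- The ultraproduct. -/
abbrev Ultraproduct : Type u := RescaledUltraproduct natUltrafilter A.X A.scale A.base

theorem bound_letter (i : ULift.{u} ℕ) (g : G) :
    (A.scale i : ℝ) * dist (A.act i (letter S g) (A.base i)) (A.base i) ≤ 1 := by
  by_cases hg : g ∈ S
  · rw [letter_of_mem hg]
    exact A.bound i _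
  · simp [letter_of_notMem hg]

/-- The family of isometries given by a sequence of elements of `S`. -/
noncomputable def ofSeq (w : ULift.{u} ℕ → G) : A.Isometries :=
  ⟨fun i => A.act i (letter S (w i)), 1, fun i => A.bound_letter i (w i)⟩

/-- The diagonal homomorphism. -/
noncomputable def ofWord : FreeGroup S →* A.Isometries :=
  (MonoidHom.pi A.act).codRestrict _ fun a => by
    induction a using FreeGroup.induction_on with
    | C1 => rw [map_one]; exact one_mem _
    | of s => exact ⟨1, fun i => A.bound i s⟩
    | inv_of s h => rw [map_inv]; exact inv_mem h
    | mul a b ha hb => rw [map_mul]; exact mul_mem ha hb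

theorem ofWord_val (a : FreeGroup S) (i : ULift.{u} ℕ) : (A.ofWord a).1 i = A.act i a := rfl

/-- A fixed relation has some finite length, so it acts trivially on almost all of the spaces. -/
theorem ofWord_smul_eq (a : FreeGroup S) (ha : evalWord S a = 1) (c : A.Ultraproduct) :
    A.ofWord a • c = c := by
  obtain ⟨y, rfl⟩ := SeparationQuotient.surjective_mk c
  rw [← dist_eq_zero]
  refine tendsto_nhds_unique (boundedIsometries.tendsto_dist_smul (A.ofWord a) y) ?_
  obtain ⟨n, hn⟩ := exists_isShort a
  refine tendsto_const_nhds.congr' ?_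
  filter_upwards [eventually_le_natUltrafilter n] with i hi
  rw [ofWord_val, A.act_relation i a ⟨ha, hn.mono (by omega)⟩]
  simp

variable [TopologicalSpace G] (N : AdaptedNhds S)

/-- The families of isometries given by elements of `S` that tend to the identity. -/
noncomputable def infinitesimals : Subgroup A.Isometries where
  carrier := {v | ∀ k, ∀ᶠ i in (natUltrafilter : Filter (ULift.{u} ℕ)),
    ∃ g ∈ N.V k, v.1 i = A.act i (letter S g)}
  one_mem' := fun k => Eventually.of_forall fun i => by
    have h1 := mem_of_mem_nhds (N.mem_nhds k)
    exact ⟨1, h1, (map_letter_one (A.act_relation i) (by omega) (N.subset k h1)).symm⟩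
  mul_mem' := by
    intro v w hv hw k
    filter_upwards [hv (k + 1), hw (k + 1)] with i ⟨a, ha, hva⟩ ⟨b, hb, hwb⟩
    have hab := N.mul_mem k a ha b hb
    refine ⟨a * b, hab, ?_⟩
    rw [map_letter_mul (A.act_relation i) (by omega) (N.subset _ ha) (N.subset _ hb)
      (N.subset _ hab), ← hva, ← hwb]
    rfl
  inv_mem' := by
    intro v hv k
    filter_upwards [hv k] with i ⟨a, ha, hva⟩
    have ha' := N.inv_mem k a ha
    refine ⟨a⁻¹, ha', ?_⟩
    rw [map_letter_inv (A.act_relation i) (by omega)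
      (N.subset k (mem_of_mem_nhds (N.mem_nhds k))) (N.subset _ ha) (N.subset _ ha'), ← hva]
    rfl

theorem ofSeq_mem_infinitesimals {w : ULift.{u} ℕ → G}
    (hw : ∀ k, ∀ᶠ i in (natUltrafilter : Filter (ULift.{u} ℕ)), w i ∈ N.V k) :
    A.ofSeq w ∈ A.infinitesimals N :=
  fun k => (hw k).mono fun i hi => ⟨w i, hi, rfl⟩

/-- The points of the ultraproduct that are fixed by the infinitesimal families. -/
abbrev continuousPoints : Set A.Ultraproduct :=
  MulAction.fixedPoints (A.infinitesimals N) A.Ultraproduct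

theorem tendsto_of_mem_continuousPoints {y : PreUltraproduct natUltrafilter A.X A.scale A.base}
    (hy : (SeparationQuotient.mk y : A.Ultraproduct) ∈ A.continuousPoints N)
    {w : ULift.{u} ℕ → G}
    (hw : ∀ k, ∀ᶠ i in (natUltrafilter : Filter (ULift.{u} ℕ)), w i ∈ N.V k) :
    Tendsto (fun i => (A.scale i : ℝ) * dist (A.act i (letter S (w i)) (y.1 i)) (y.1 i))
      (natUltrafilter : Filter (ULift.{u} ℕ)) (𝓝 0) := by
  have h : A.ofSeq w • (SeparationQuotient.mk y : A.Ultraproduct) = SeparationQuotient.mk y :=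
    hy ⟨_, A.ofSeq_mem_infinitesimals N hw⟩
  have := boundedIsometries.tendsto_dist_smul (A.ofSeq w) y
  rwa [h, dist_self] at this

/-- An infinitesimal family is given by single letters for almost all indices, so it moves the base
point by at most `1`; the orbit is bounded. -/
theorem continuousPoints_nonempty (h : IsUniformlyConvex A.Ultraproduct) :
    (A.continuousPoints N).Nonempty := by
  refine h.exists_fixedPoint (SeparationQuotient.mk ⟨A.base, 0, fun i => by simp⟩) (C := 1) ?_
  rintro ⟨v, hv⟩
  refine le_of_tendsto (boundedIsometries.tendsto_dist_smul v _) ?_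
  filter_upwards [hv 0] with i ⟨g, _, hg⟩
  rw [hg]
  exact A.bound_letter i g

/-- Letters normalise the infinitesimals, since conjugation by `S` costs only one level of the
sequence `N.V`. -/
theorem ofWord_smul_mem (hinv : ∀ s ∈ S, s⁻¹ ∈ S) (a : FreeGroup S) :
    ∀ c ∈ A.continuousPoints N, A.ofWord a • c ∈ A.continuousPoints N := by
  have key : ∀ s ∈ S, ∀ c ∈ A.continuousPoints N,
      A.ofWord (letter S s) • c ∈ A.continuousPoints N := by
    rintro s hs c hc ⟨v, hv⟩
    have hconj : (A.ofWord (letter S s))⁻¹ * v * A.ofWord (letter S s) ∈ A.infinitesimals N := by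
      intro k
      filter_upwards [hv (k + 1)] with i ⟨g, hg, hvg⟩
      have hs' := hinv s hs
      have hsg := N.conj_mem k _ hs' g hg
      refine ⟨_, hsg, ?_⟩
      have hone := N.subset k (mem_of_mem_nhds (N.mem_nhds k))
      rw [map_letter_conj (A.act_relation i) (by omega) hs' (N.subset _ hg) (N.subset _ hsg),
        map_letter_inv (A.act_relation i) (by omega) hone hs hs', inv_inv, ← hvg]
      rfl
    have : ((A.ofWord (letter S s))⁻¹ * v * A.ofWord (letter S s)) • c = c := hc ⟨_, hconj⟩
    rw [mul_smul, mul_smul, inv_smul_eq_iff] at this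
    exact this
  induction a using FreeGroup.induction_on with
  | C1 => intro c hc; rwa [map_one, one_smul]
  | of s =>
    have := key s s.2
    rwa [letter_of_mem s.2] at this
  | inv_of s _ =>
    intro c hc
    have h1 := key _ (hinv s s.2) c hc
    have h2 : A.ofWord (letter S (s : G)⁻¹) = A.ofWord (FreeGroup.of s)⁻¹ := by
      refine Subtype.ext (funext fun i => ?_)
      have hone := N.subset 0 (mem_of_mem_nhds (N.mem_nhds 0))
      rw [ofWord_val, ofWord_val, map_letter_inv (A.act_relation i) (by omega) hone s.2
        (hinv s s.2), letter_of_mem s.2, map_inv]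
    rwa [h2] at h1
  | mul a b ha hb =>
    intro c hc
    rw [map_mul, mul_smul]
    exact ha _ (hb _ hc)

/-- The limit action of `G` on the continuous points of the ultraproduct. -/
theorem exists_limit_action (hinv : ∀ s ∈ S, s⁻¹ ∈ S) (hgen : Subgroup.closure S = ⊤) :
    ∃ θ : G →* Equiv.Perm (A.continuousPoints N), ∀ (a : FreeGroup S) (c : A.continuousPoints N),
      (θ (evalWord S a) c : A.Ultraproduct) = A.ofWord a • (c : A.Ultraproduct) := by
  let _ : MulAction (FreeGroup S) (A.continuousPoints N) :=
    { smul := fun a c => ⟨A.ofWord a • (c : A.Ultraproduct), A.ofWord_smul_mem N hinv a c c.2⟩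
      one_smul := fun c => Subtype.ext (by
        change A.ofWord 1 • (c : A.Ultraproduct) = c
        rw [map_one, one_smul])
      mul_smul := fun a b c => Subtype.ext (by
        change A.ofWord (a * b) • (c : A.Ultraproduct) = A.ofWord a • A.ofWord b • _
        rw [map_mul, mul_smul]) }
  let ψ : FreeGroup S →* Equiv.Perm (A.continuousPoints N) := MulAction.toPermHom _ _
  have hψ : (evalWord S).ker ≤ ψ.ker := fun a ha =>
    Equiv.ext fun c => Subtype.ext (A.ofWord_smul_eq a ha c)
  have hsurj := Function.rightInverse_surjInv (surjective_evalWord hgen)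
  refine ⟨(evalWord S).liftOfRightInverse _ hsurj ⟨ψ, hψ⟩, fun a c => ?_⟩
  rw [MonoidHom.liftOfRightInverse_comp_apply]
  rfl

/-- At a continuous point the orbit map of `S` is equicontinuous at the identity. -/
theorem exists_forall_dist_le {c : A.Ultraproduct} (hc : c ∈ A.continuousPoints N) {ε : ℝ}
    (hε : 0 < ε) : ∃ k, ∀ g ∈ N.V k, dist (A.ofWord (letter S g) • c) c ≤ ε := by
  classical
  obtain ⟨y, rfl⟩ := SeparationQuotient.surjective_mk c
  suffices h : ∃ k, ∀ᶠ i in (natUltrafilter : Filter (ULift.{u} ℕ)), ∀ g ∈ N.V k,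
      (A.scale i : ℝ) * dist (A.act i (letter S g) (y.1 i)) (y.1 i) ≤ ε by
    obtain ⟨k, hk⟩ := h
    exact ⟨k, fun g hg => le_of_tendsto (boundedIsometries.tendsto_dist_smul (A.ofWord (letter S g)) y)
      (hk.mono fun i hi => hi g hg)⟩
  by_contra! hbad
  let P : ULift.{u} ℕ → ℕ → G → Prop := fun i k g => g ∈ N.V k ∧
    ε < (A.scale i : ℝ) * dist (A.act i (letter S g) (y.1 i)) (y.1 i)
  have hP : ∀ k, ∀ᶠ i in (natUltrafilter : Filter (ULift.{u} ℕ)), ∃ g, P i k g :=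
    fun k => hbad k
  -- Diagonal choice: take the deepest level up to `i` containing a bad element. The resulting `w`
  -- is infinitesimal but moves `y` by more than `ε`.
  let m : ULift.{u} ℕ → ℕ := fun i => Nat.findGreatest (fun k => ∃ g, P i k g) i.down
  let w : ULift.{u} ℕ → G := fun i => if h : ∃ g, P i (m i) g then h.choose else 1
  have hw : ∀ k, ∀ᶠ i in (natUltrafilter : Filter (ULift.{u} ℕ)), P i k (w i) := by
    intro k
    filter_upwards [hP k, eventually_le_natUltrafilter k] with i hi hki
    have h1 : ∃ g, P i (m i) g := Nat.findGreatest_spec (P := fun k => ∃ g, P i k g) hki hi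
    have h2 : k ≤ m i := Nat.le_findGreatest hki hi
    have h3 : w i = h1.choose := dif_pos h1
    rw [h3]
    exact ⟨N.antitone h2 h1.choose_spec.1, h1.choose_spec.2⟩
  have hlim := A.tendsto_of_mem_continuousPoints N hc fun k => (hw k).mono fun i hi => hi.1
  exact absurd (ge_of_tendsto hlim ((hw 0).mono fun i hi => hi.2.le)) (not_le.2 hε)

/-- If a continuous point of the ultraproduct is fixed by `S`, then it is represented by almost
fixed points. -/
theorem eventually_forall_dist_lt [IsTopologicalGroup G] (hSc : IsCompact S)
    {y : PreUltraproduct natUltrafilter A.X A.scale A.base}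
    (hy : (SeparationQuotient.mk y : A.Ultraproduct) ∈ A.continuousPoints N)
    (hfix : ∀ s ∈ S, A.ofWord (letter S s) • (SeparationQuotient.mk y : A.Ultraproduct) =
      SeparationQuotient.mk y) {ε : ℝ} (hε : 0 < ε) :
    ∀ᶠ i in (natUltrafilter : Filter (ULift.{u} ℕ)), ∀ s ∈ S,
      (A.scale i : ℝ) * dist (A.act i (letter S s) (y.1 i)) (y.1 i) < ε := by
  classical
  by_contra hbad
  rw [← Ultrafilter.eventually_not] at hbad
  push Not at hbad
  let t : ULift.{u} ℕ → G := fun i => if h : ∃ s ∈ S,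
    ε ≤ (A.scale i : ℝ) * dist (A.act i (letter S s) (y.1 i)) (y.1 i) then h.choose else 1
  have ht : ∀ᶠ i in (natUltrafilter : Filter (ULift.{u} ℕ)), t i ∈ S ∧
      ε ≤ (A.scale i : ℝ) * dist (A.act i (letter S (t i)) (y.1 i)) (y.1 i) := by
    filter_upwards [hbad] with i hi
    have : t i = hi.choose := dif_pos hi
    rw [this]
    exact hi.choose_spec
  -- The bad elements converge to some `s ∈ S`, so `t i = s * w i` with `w` infinitesimal. Both
  -- factors have displacement tending to `0`.
  obtain ⟨s, hs, hts⟩ := hSc.ultrafilter_le_nhds (natUltrafilter.map t)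
    (le_principal_iff.2 (ht.mono fun i hi => hi.1))
  have hts' : Tendsto t (natUltrafilter : Filter (ULift.{u} ℕ)) (𝓝 s) := hts
  let w : ULift.{u} ℕ → G := fun i => s⁻¹ * t i
  have hw1 : Tendsto w (natUltrafilter : Filter (ULift.{u} ℕ)) (𝓝 1) := by
    simpa using hts'.const_mul s⁻¹
  have hw : ∀ k, ∀ᶠ i in (natUltrafilter : Filter (ULift.{u} ℕ)), w i ∈ N.V k :=
    fun k => hw1.eventually_mem (N.mem_nhds k)
  have h1 := A.tendsto_of_mem_continuousPoints N hy hw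
  have h2 := boundedIsometries.tendsto_dist_smul (A.ofWord (letter S s)) y
  rw [hfix s hs, dist_self] at h2
  have h3 := h1.add h2
  rw [add_zero] at h3
  refine absurd (ge_of_tendsto h3 ?_) (not_le.2 hε)
  filter_upwards [ht, hw 0] with i hi hwi
  refine hi.2.trans ?_
  have hmul : A.act i (letter S (t i)) =
      A.act i (letter S s) * A.act i (letter S (w i)) := by
    have h := map_letter_mul (A.act_relation i) (by omega) hs (N.subset _ hwi)
      (by simpa [w] using hi.1)
    rwa [show s * w i = t i by simp [w]] at h
  rw [hmul, ofWord_val, ← mul_add]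
  refine mul_le_mul_of_nonneg_left ?_ (A.scale i).coe_nonneg
  rw [IsometryEquiv.mul_apply]
  refine (dist_triangle _ (A.act i (letter S s) (y.1 i)) _).trans ?_
  rw [IsometryEquiv.dist_eq]

end ApproximateAction

end ApproximateAction

/-! ### The contradiction and the main theorem -/

variable {G : Type v} [Group G] {S : Set G} {F : MetricFamily.{u}}

/-- A group with the fixed point property has no sequence of approximate actions on members of the
family in which the displacement is bounded below on larger and larger balls. -/
theorem ApproximateAction.not_displacement [TopologicalSpace G] [IsTopologicalGroup G]
    (huc : F.ConsistsOfUniformlyConvex)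
    (hultra : F.StableUnderRescaledUltraproducts)
    (hsub : F.StableUnderClosedConvexSubspaces ∨
      (F.ConsistsOfBanachSpaces ∧ F.StableUnderClosedVectorSubspaces))
    (hGF : HasFixedPointProperty G F)
    (hSc : IsCompact S) (hS : S ∈ 𝓝 (1 : G)) (hinv : ∀ s ∈ S, s⁻¹ ∈ S)
    (hgen : Subgroup.closure S = ⊤)
    (A : ApproximateAction.{u} S) (hF : ∀ i, F (A.X i)) (hscale : ∀ i, 0 < A.scale i) :
    ¬ ∀ i, ∀ y : A.X i, (A.scale i : ℝ) * dist (A.base i) y ≤ i.down + 1 → ∃ s : S,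
      1 / 4 ≤ (A.scale i : ℝ) * dist (A.act i (FreeGroup.of s) y) y := by
  intro hdisp
  obtain ⟨N⟩ := AdaptedNhds.nonempty hSc hS hinv
  have hFU : F A.Ultraproduct := hultra _ _ _ _ _ hF hscale
  have hne := A.continuousPoints_nonempty N (huc _ hFU)
  have hFC : F (A.continuousPoints N) := MetricFamily.fixedPoints_mem huc hsub hFU hne
  obtain ⟨θ, hθ⟩ := A.exists_limit_action N hinv hgen
  let _ : MulAction G (A.continuousPoints N) := MulAction.compHom _ θ
  have hsmul : ∀ (a : FreeGroup S) (c : A.continuousPoints N),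
      ((evalWord S a • c : A.continuousPoints N) : A.Ultraproduct) =
        A.ofWord a • (c : A.Ultraproduct) := hθ
  have hiso : IsIsometricSMul G (A.continuousPoints N) := ⟨fun g => Isometry.of_dist_eq fun c d => by
    obtain ⟨a, rfl⟩ := surjective_evalWord hgen g
    rw [Subtype.dist_eq, hsmul, hsmul, dist_smul, Subtype.dist_eq]⟩
  have hcont : ContinuousSMul G (A.continuousPoints N) := by
    refine ⟨continuous_iff_continuousAt.2 fun ⟨g₀, c₀⟩ => Metric.tendsto_nhds.2 fun ε hε => ?_⟩
    obtain ⟨k, hk⟩ := A.exists_forall_dist_le N c₀.2 (by positivity : 0 < ε / 3)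
    have h1 : ∀ᶠ g in 𝓝 g₀, g₀⁻¹ * g ∈ N.V k := by
      have hc : Continuous fun g : G => g₀⁻¹ * g := by fun_prop
      refine hc.continuousAt.eventually_mem ?_
      simpa using N.mem_nhds k
    have h2 : ∀ᶠ c in 𝓝 c₀, dist c c₀ < ε / 3 := Metric.ball_mem_nhds _ (by positivity)
    rw [nhds_prod_eq]
    filter_upwards [h1.prod_mk h2] with ⟨g, c⟩ ⟨hg, hc⟩
    have h3 : dist (g • c₀) (g₀ • c₀) ≤ ε / 3 := by
      rw [← dist_smul g₀⁻¹, smul_smul, inv_smul_smul, ← evalWord_letter (N.subset k hg),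
        Subtype.dist_eq, hsmul]
      exact hk _ hg
    calc dist (g • c) (g₀ • c₀) ≤ dist (g • c) (g • c₀) + dist (g • c₀) (g₀ • c₀) :=
          dist_triangle _ _ _
      _ < ε := by
        rw [dist_smul]
        linarith
  have : Nonempty (A.continuousPoints N) := hne.to_subtype
  obtain ⟨⟨c, hc⟩, hfix⟩ := hGF (A.continuousPoints N) hFC
  obtain ⟨y, rfl⟩ := SeparationQuotient.surjective_mk c
  have hev := A.eventually_forall_dist_lt N hSc hc (fun s hs => by
    rw [← hsmul (letter S s) ⟨_, hc⟩, evalWord_letter hs, hfix]) (ε := 1 / 4) (by norm_num)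
  obtain ⟨D, hD⟩ := y.2
  obtain ⟨k, hk⟩ := exists_nat_ge D
  -- For `i ≥ D` the representative `y.1 i` lies in the ball where some letter has displacement at
  -- least `1 / 4`.
  obtain ⟨i, hi, hki⟩ := (hev.and (eventually_le_natUltrafilter k)).exists
  have hki' : (k : ℝ) ≤ i.down := by exact_mod_cast hki
  obtain ⟨s, hs⟩ := hdisp i (y.1 i) (by linarith [hD i])
  have := hi s s.2
  rw [letter_of_mem s.2] at this
  linarith

/-- If the truncated group, with a topology as above, fails to have the fixed point property, then
its actions without fixed points can be rescaled. -/
theorem TruncatedGroup.exists_action_of_not_hasFixedPointProperty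
    (huc : F.ConsistsOfUniformlyConvex) {n : ℕ} [TopologicalSpace (TruncatedGroup S n)]
    (hc : IsCompact (TruncatedGroup.incl S n '' S))
    (hnot : ¬ HasFixedPointProperty (TruncatedGroup S n) F) {N : ℝ} (hN : 0 < N) :
    ∃ (X : Type u) (_ : MetricSpace X) (ρ : FreeGroup S →* (X ≃ᵢ X)) (l : ℝ≥0) (x : X),
      F X ∧ 0 < l ∧ (∀ r ∈ shortRelations S n, ρ r = 1) ∧
      (∀ s : S, (l : ℝ) * dist (ρ (FreeGroup.of s) x) x ≤ 1) ∧
      ∀ y, (l : ℝ) * dist x y ≤ N → ∃ s : S, 1 / 4 ≤ (l : ℝ) * dist (ρ (FreeGroup.of s) y) y := by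
  unfold HasFixedPointProperty at hnot
  push Not at hnot
  obtain ⟨X, _, _, hFX, _, _, _, hfix⟩ := hnot
  have := (huc X hFX).complete
  let ρ₀ : TruncatedGroup S n →* (X ≃ᵢ X) :=
    { toFun := fun g => IsometryEquiv.constSMul g
      map_one' := IsometryEquiv.ext fun x => one_smul _ x
      map_mul' := fun g h => IsometryEquiv.ext fun x => mul_smul g h x }
  have hincl : ∀ s : S, TruncatedGroup.incl S n (s : G) =
      TruncatedGroup.ofWord S n (FreeGroup.of s) := fun s => by
    rw [TruncatedGroup.incl, letter_of_mem s.2]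
  obtain ⟨x, l, hl, h1, h2⟩ := exists_rescaled_displacement hfix
    (TruncatedGroup.closure_incl_image S n) (fun x => (hc.image (by fun_prop)).bddAbove) hN
  refine ⟨X, inferInstance, ρ₀.comp (TruncatedGroup.ofWord S n), l, x, hFX, hl, ?_, ?_, ?_⟩
  · intro r hr
    rw [MonoidHom.comp_apply, TruncatedGroup.ofWord_shortRelations S n r hr, map_one]
  · intro s
    have := h1 _ ⟨s, s.2, rfl⟩
    rwa [hincl] at this
  · intro y hy
    obtain ⟨_, ⟨s, hs, rfl⟩, h⟩ := h2 y hy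
    refine ⟨⟨s, hs⟩, ?_⟩
    rwa [hincl ⟨s, hs⟩] at h

end FixedPointFamily

theorem theoremC (F : FixedPointFamily.MetricFamily.{u})
    (huc : F.ConsistsOfUniformlyConvex)
    (hultra : F.StableUnderRescaledUltraproducts)
    (hsub : F.StableUnderClosedConvexSubspaces ∨
      (F.ConsistsOfBanachSpaces ∧ F.StableUnderClosedVectorSubspaces))
    (G : Type v) [Group G] [TopologicalSpace G] [IsTopologicalGroup G] [T2Space G]
    [LocallyCompactSpace G]
    (hG : FixedPointFamily.IsCompactlyGenerated G)
    (hGF : FixedPointFamily.HasFixedPointProperty G F) :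
    ∃ (G' : Type v) (_ : Group G') (_ : TopologicalSpace G') (_ : IsTopologicalGroup G')
      (_ : T2Space G') (_ : LocallyCompactSpace G'),
      FixedPointFamily.IsCompactlyPresented G' ∧
      FixedPointFamily.HasFixedPointProperty G' F ∧
      ∃ f : G' →* G, Continuous f ∧ Function.Surjective f ∧ DiscreteTopology f.ker := by
  open FixedPointFamily in
  obtain ⟨S, hSc, hS, hinv, hgen⟩ := hG.exists_symmetric_nhds
  by_contra hcon
  have key : ∀ i : ULift.{u} ℕ,
      ∃ (X : Type u) (_ : MetricSpace X) (ρ : FreeGroup S →* (X ≃ᵢ X)) (l : ℝ≥0) (x : X),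
        F X ∧ 0 < l ∧ (∀ r ∈ shortRelations S (i.down + 4), ρ r = 1) ∧
        (∀ s : S, (l : ℝ) * dist (ρ (FreeGroup.of s) x) x ≤ 1) ∧
        ∀ y, (l : ℝ) * dist x y ≤ i.down + 1 →
          ∃ s : S, 1 / 4 ≤ (l : ℝ) * dist (ρ (FreeGroup.of s) y) y := by
    intro i
    obtain ⟨_, _, _, _, hcont, hto, hdisc⟩ :=
      TruncatedGroup.exists_topology (n := i.down + 4) (by omega) hSc hS hinv
    have hc := hSc.image_of_continuousOn hcont
    refine TruncatedGroup.exists_action_of_not_hasFixedPointProperty huc hc (fun h => hcon ?_)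
      (by positivity)
    exact ⟨TruncatedGroup S (i.down + 4), inferInstance, inferInstance, inferInstance,
      inferInstance, inferInstance, TruncatedGroup.isCompactlyPresented hc, h,
      TruncatedGroup.toGroup S _, hto, TruncatedGroup.surjective_toGroup hgen, hdisc⟩
  choose X metric ρ l x hFX hl hrel hbound hdisp using key
  exact ApproximateAction.not_displacement huc hultra hsub hGF hSc hS hinv hgen
    ⟨X, metric, ρ, l, x, hrel, hbound⟩ hFX hl hdisp
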